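/- Let $d,n,m\ge 0$ be integers, let $p=(p_1,\dots,p_n)$ and $q=(q_1,\dots,q_m)$ be configurations of points in $\mathbb R^d$, and let $(K(n,m),p,q)$ be the associated framework of the complete bipartite graph $K(n,m)$. For $x\in\mathbb R^d$ let $\hat x\in\mathbb R^{d+1}$ be $x$ with a last coordinate $1$ added, and let $\mathcal V(x)=\hat x\hat x^t$, a symmetric $(d+1)\times(d+1)$ matrix. A configuration (a family of points indexed by a finite set) in $\mathbb R^d$ is in *quadric general position* if for every $k=1,\dots,\frac{(d+1)(d+2)}2-1$ the images under $\mathcal V$ of every $k+1$ of its points (with $k+1$ different indices) span a $k$-dimensional affine subspace. Two configurations $p',q'$ in $\mathbb R^d$ are *strictly separated by a quadric* if there is a non-zero symmetric real $(d+1)\times(d+1)$ matrix $A$ such that $\hat y^tA\hat y<0<\hat x^tA\hat x$ for all points $x$ of $p'$ and $y$ of $q'$. A *stress* of a framework $(G,r)$ with $N$ vertices $r_1,\dots,r_N$ is an assignment of reals $\omega_{ij}=\omega_{ji}$ with $\omega_{ij}=0$ whenever $\{i,j\}$ is not an edge of $G$; it is an *equilibrium stress* if $\sum_i\omega_{ij}(r_i-r_j)=0$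 for every vertex $j$. Its *stress matrix* $\Omega$ has off-diagonal entries $-\omega_{ij}$ and the diagonal entries that make all row sums $0$. A framework $(G,r)$ with affine span $\mathbb R^d$ is *super stable* if it has an equilibrium stress whose stress matrix is positive semidefinite of rank $N-d-1$, and there is no non-zero symmetric $d\times d$ matrix $Q$ with $(r_i-r_j)^tQ(r_i-r_j)=0$ for all edges $\{i,j\}$ of $G$. (If the affine span has a smaller dimension $d'$, the framework is called super stable if it is so after being placed isometrically in $\mathbb R^{d'}$.) **Statement.** Suppose that there are subconfigurations $p'=(p_i)_{i\in I}$ of $p$ and $q'=(q_j)_{j\in J}$ of $q$, where $I\subseteq\{1,\dots,n\}$ and $J\subseteq\{1,\dots,m\}$, such that the joint configuration $(p',q')$ is in quadric general position in $\mathbb R^d$ and no quadric strictly separates $p'$ and $q'$. Then $(K(n,m),p,q)$ is super stable and $$n+m\ \ge\ \frac{(d+1)(d+2)}2+1 .$$ Moreover, the affine span of $p$ and the affine span of $q$ coincide, and both equal $\mathbb R^d$. -/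

import Mathlib

open scoped Matrix

/-! ### Frameworks and stresses -/

/-- A stress of the graph `G`: a symmetric assignment of real scalars to pairs of vertices that
vanishes outside the edges. -/
def IsStress {V : Type*} (G : SimpleGraph V) (ω : V → V → ℝ) : Prop :=
  (∀ i j, ω i j = ω j i) ∧ ∀ i j, ¬ G.Adj i j → ω i j = 0

/-- An equilibrium stress of the framework `(G, p)` in `ℝ^d`:
`∑ i, ω i j (p i - p j) = 0` at every vertex `j`. -/
def IsEquilibriumStress {V : Type*} [Fintype V] {d : ℕ} (G : SimpleGraph V)
    (p : V → EuclideanSpace ℝ (Fin d)) (ω : V → V → ℝ) : Prop :=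
  IsStress G ω ∧ ∀ j, ∑ i, ω i j • (p i - p j) = 0

/-- The stress matrix of `ω`: off-diagonal entries `-ω i j`, and the diagonal entries that make
all row sums zero (a stress vanishes on the diagonal, since a graph has no loops). -/
def stressMatrix {V : Type*} [Fintype V] [DecidableEq V] (ω : V → V → ℝ) : Matrix V V ℝ :=
  Matrix.of fun i j => if i = j then ∑ k, ω i k else -ω i j

/-- The row sums of a stress matrix are zero. -/
theorem stressMatrix_row_sum {V : Type*} [Fintype V] [DecidableEq V] {G : SimpleGraph V}
    {ω : V → V → ℝ} (h : IsStress G ω) (i : V) : ∑ j, stressMatrix ω i j = 0 := by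
  have h0 : ω i i = 0 := h.2 i i (G.loopless.irrefl i)
  have h1 : ∀ j, stressMatrix ω i j = (if i = j then ∑ k, ω i k else 0) - ω i j := by
    intro j
    by_cases hij : i = j
    · subst hij
      simp [stressMatrix, h0]
    · simp [stressMatrix, hij]
  simp [h1, Finset.sum_sub_distrib]

/-- The vectors in `S` lie on a conic at infinity of `ℝ^d`: they are all zeros of one non-zero
quadratic form. (A zero vector imposes no condition.) -/
def OnConicAtInfinity {d : ℕ} (S : Set (EuclideanSpace ℝ (Fin d))) : Prop :=
  ∃ Q : Matrix (Fin d) (Fin d) ℝ, Q.IsSymm ∧ Q ≠ 0 ∧ ∀ v ∈ S, v.ofLp ⬝ᵥ (Q *ᵥ v.ofLp) = 0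

/-- The edge directions `p i - p j` of a framework, for `{i, j}` an edge. -/
def edgeDirections {V : Type*} {d : ℕ} (G : SimpleGraph V)
    (p : V → EuclideanSpace ℝ (Fin d)) : Set (EuclideanSpace ℝ (Fin d)) :=
  {v | ∃ i j, G.Adj i j ∧ v = p i - p j}

/-- Super stability of a framework in `ℝ^d` whose affine span is all of `ℝ^d`: it has an
equilibrium stress whose stress matrix is positive semidefinite of rank `N - d - 1`, with `N` the
number of vertices, and its edge directions do not lie on a conic at infinity. -/
def SpansAndSuperStable {V : Type*} [Fintype V] [DecidableEq V] {d : ℕ} (G : SimpleGraph V)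
    (p : V → EuclideanSpace ℝ (Fin d)) : Prop :=
  affineSpan ℝ (Set.range p) = ⊤ ∧
  (∃ ω : V → V → ℝ, IsEquilibriumStress G p ω ∧ (stressMatrix ω).PosSemidef ∧
    (stressMatrix ω).rank + (d + 1) = Fintype.card V) ∧
  ¬ OnConicAtInfinity (edgeDirections G p)

/-- Super stability of a framework in `ℝ^d`. If the affine span has a smaller dimension `d'`, the
framework is rigidly placed in `ℝ^d'`; if the affine span is `ℝ^d`, then `d' = d` is forced and
this is `SpansAndSuperStable`. -/
def IsSuperStable {V : Type*} [Fintype V] [DecidableEq V] {d : ℕ} (G : SimpleGraph V)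
    (p : V → EuclideanSpace ℝ (Fin d)) : Prop :=
  ∃ (d' : ℕ) (f : EuclideanSpace ℝ (Fin d') →ᵃⁱ[ℝ] EuclideanSpace ℝ (Fin d))
    (p' : V → EuclideanSpace ℝ (Fin d')), (∀ i, p i = f (p' i)) ∧ SpansAndSuperStable G p'

/-! ### Quadrics and the Veronese map -/

/-- `x̂ ∈ ℝ^(d+1)`: the vector `x ∈ ℝ^d` with a `1` added as the last coordinate. -/
def hat {d : ℕ} (x : EuclideanSpace ℝ (Fin d)) : Fin (d + 1) → ℝ :=
  Fin.snoc (α := fun _ => ℝ) x.ofLp 1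

/-- The families `p` and `q` are strictly separated by the quadric `{x | x̂ᵗ A x̂ = 0}` of some
non-zero symmetric matrix `A`: `q̂ⱼᵗ A q̂ⱼ < 0 < p̂ᵢᵗ A p̂ᵢ` for all `i` and `j`. -/
def StrictlySeparatedByQuadric {ι κ : Type*} {d : ℕ} (p : ι → EuclideanSpace ℝ (Fin d))
    (q : κ → EuclideanSpace ℝ (Fin d)) : Prop :=
  ∃ A : Matrix (Fin (d + 1)) (Fin (d + 1)) ℝ, A.IsSymm ∧ A ≠ 0 ∧
    (∀ i, 0 < hat (p i) ⬝ᵥ (A *ᵥ hat (p i))) ∧ ∀ j, hat (q j) ⬝ᵥ (A *ᵥ hat (q j)) < 0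

/-- The Veronese map `x ↦ x̂ x̂ᵗ`, with values in the `(d+1) × (d+1)` (symmetric) matrices. -/
def veronese {d : ℕ} (x : EuclideanSpace ℝ (Fin d)) : Matrix (Fin (d + 1)) (Fin (d + 1)) ℝ :=
  Matrix.vecMulVec (hat x) (hat x)

/-- A configuration (indexed family) in `ℝ^d` is in quadric general position: for
`k = 1, …, (d+1)(d+2)/2 - 1`, the Veronese images of every `k + 1` of its points span a
`k`-dimensional affine subspace. -/
def QuadricGeneralPosition {ι : Type*} {d : ℕ} (p : ι → EuclideanSpace ℝ (Fin d)) : Prop :=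
  ∀ k : ℕ, 1 ≤ k → k ≤ (d + 1) * (d + 2) / 2 - 1 → ∀ s : Finset ι, s.card = k + 1 →
    Module.finrank ℝ (affineSpan ℝ ((fun i => veronese (p i)) '' (s : Set ι))).direction = k

/-! ### Homogeneous coordinates -/

section Hat

variable {d : ℕ}

/-! Write D = (d+1)(d+2)/2 for the dimension of the space of symmetric matrices. A quadric evaluates
linearly on Veronese images, so Gordan's alternative turns non-separation of p' and q' into a
non-trivial non-negative dependency among the vectors V(p'_i) and -V(q'_j). Quadric general position
makes any D of these independent, so the support has more than D points (hence the bound on n + m)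
and its Veronese images span all symmetric matrices. `exists_pos_dependency` then makes the weights
positive on all of p and q (`exists_pos_weights_of_not_separated`).

In matrix form this says M = ∑ a_i x_i x_iᵗ = ∑ b_j y_j y_jᵗ with x_i, y_j the homogeneous
coordinates of the points. Here M is invertible, and ω_ij = a_i b_j x_iᵗ M⁻¹ y_j is the required
stress: its matrix has diagonal entries a_i and b_j, its kernel consists of the affine functions of
the points, and its quadratic form is a sum of squares (`spansAndSuperStable_of_momentMatrix_eq`).
Since either family alone determines M, each of p and q affinely spans the space, which also
excludes a conic at infinity. -/

theorem hat_last (x : EuclideanSpace ℝ (Fin d)) : hat x (Fin.last d) = 1 := by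
  simp [hat]

theorem hat_dotProduct_snoc (x : EuclideanSpace ℝ (Fin d)) (v : Fin d → ℝ) (c : ℝ) :
    hat x ⬝ᵥ (Fin.snoc (α := fun _ => ℝ) v c) = x.ofLp ⬝ᵥ v + c := by
  simp [hat, dotProduct, Fin.sum_univ_castSucc]

/-- If no non-zero vector is orthogonal to all `hat (p i)`, then the points `p i` affinely
span the space. -/
theorem affineSpan_eq_top_of_hat {ι : Type*} (p : ι → EuclideanSpace ℝ (Fin d))
    (h : ∀ u, (∀ i, hat (p i) ⬝ᵥ u = 0) → u = 0) : affineSpan ℝ (Set.range p) = ⊤ := by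
  by_cases hne : Nonempty ι
  · obtain ⟨i₀⟩ := hne
    have hmem : ∀ i, p i ∈ affineSpan ℝ (Set.range p) := fun i =>
      mem_affineSpan ℝ (Set.mem_range_self i)
    rw [← AffineSubspace.direction_eq_top_iff_of_nonempty ⟨p i₀, hmem i₀⟩]
    by_contra hdir
    obtain ⟨f, hf, hle⟩ := Submodule.exists_le_ker_of_lt_top _ (lt_top_iff_ne_top.2 hdir)
    set v : Fin d → ℝ := fun k => f (EuclideanSpace.single k 1) with hv
    have hfv : ∀ x : EuclideanSpace ℝ (Fin d), f x = x.ofLp ⬝ᵥ v := by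
      intro x
      conv_lhs => rw [← (EuclideanSpace.basisFun (Fin d) ℝ).sum_repr x]
      simp [dotProduct, hv]
    -- This vector represents the affine function `f x - f (p i₀)`, which vanishes at every point of
    -- the family.
    have hu := h (Fin.snoc (α := fun _ => ℝ) v (-f (p i₀))) fun i => by
      have h1 : p i - p i₀ ∈ LinearMap.ker f :=
        hle (AffineSubspace.vsub_mem_direction (hmem i) (hmem i₀))
      rw [hat_dotProduct_snoc, ← hfv, ← sub_eq_add_neg, ← map_sub]
      exact h1
    apply hf
    ext x
    have hv0 : v = 0 := by
      ext k
      simpa using congrFun hu k.castSucc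
    simp [hfv, hv0]
  · have hu := h (fun _ => 1) fun i => absurd ⟨i⟩ hne
    exact absurd (congrFun hu (Fin.last d)) one_ne_zero

/-- The differences between two configurations whose homogeneous coordinate vectors are
non-degenerate do not lie on a conic at infinity. -/
theorem not_onConicAtInfinity_of_hat {α β : Type*} (p : α → EuclideanSpace ℝ (Fin d))
    (q : β → EuclideanSpace ℝ (Fin d)) (hp : ∀ u, (∀ i, hat (p i) ⬝ᵥ u = 0) → u = 0)
    (hq : ∀ u, (∀ j, hat (q j) ⬝ᵥ u = 0) → u = 0) (S : Set (EuclideanSpace ℝ (Fin d)))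
    (hS : ∀ i j, p i - q j ∈ S) : ¬ OnConicAtInfinity S := by
  rintro ⟨Q, hsymm, hne, hQ⟩
  have hcomm : ∀ x y : Fin d → ℝ, x ⬝ᵥ (Q *ᵥ y) = y ⬝ᵥ (Q *ᵥ x) := fun x y => by
    rw [Matrix.dotProduct_mulVec, ← Matrix.mulVec_transpose, hsymm.eq, dotProduct_comm]
  have hconst : ∀ j k, Q *ᵥ (q j).ofLp = Q *ᵥ (q k).ofLp := by
    intro j k
    -- In the difference of the conic equations for `p i - q j` and `p i - q k` the term quadratic
    -- in `p i` cancels. What remains is affine in `p i`, so its coefficients vanish.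
    have hu := hp (Fin.snoc (α := fun _ => ℝ) (2 • (Q *ᵥ (q j).ofLp - Q *ᵥ (q k).ofLp))
      ((q k).ofLp ⬝ᵥ (Q *ᵥ (q k).ofLp) - (q j).ofLp ⬝ᵥ (Q *ᵥ (q j).ofLp))) fun i => by
      have h1 := hQ _ (hS i j)
      have h2 := hQ _ (hS i k)
      simp only [WithLp.ofLp_sub, Matrix.mulVec_sub, dotProduct_sub, sub_dotProduct] at h1 h2
      rw [hat_dotProduct_snoc, dotProduct_smul, dotProduct_sub, two_nsmul]
      linarith [hcomm (q j).ofLp (p i).ofLp, hcomm (q k).ofLp (p i).ofLp]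
    ext r
    have := congrFun hu r.castSucc
    simp only [Fin.snoc_castSucc, two_nsmul, Pi.add_apply, Pi.sub_apply, Pi.zero_apply] at this
    linarith
  have hβ : Nonempty β := by
    by_contra hβ
    have hu := hq (fun _ => 1) fun j => absurd ⟨j⟩ hβ
    exact absurd (congrFun hu (Fin.last d)) one_ne_zero
  obtain ⟨j₀⟩ := hβ
  apply hne
  ext r s
  -- Since `Q *ᵥ q j` does not depend on `j`, each row of `Q` gives an affine function vanishing on
  -- all of `q`.
  have hu := hq (Fin.snoc (α := fun _ => ℝ) (Q r) (-(Q *ᵥ (q j₀).ofLp) r)) fun j => by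
    rw [hat_dotProduct_snoc, ← hconst j j₀, dotProduct_comm]
    exact add_neg_cancel _
  simpa using congrFun hu s.castSucc

end Hat

/-! ### The stress of a bipartite framework with two equal moment matrices -/

section BipartiteStress

variable {α β ι : Type*}

/-- The second moment matrix `∑ i, a i • x i (x i)ᵗ` of a weighted family of vectors. -/
def momentMatrix [Fintype α] (a : α → ℝ) (x : α → ι → ℝ) : Matrix ι ι ℝ :=
  ∑ i, a i • Matrix.vecMulVec (x i) (x i)

theorem momentMatrix_mulVec [Fintype α] [Fintype ι] (a : α → ℝ) (x : α → ι → ℝ) (u : ι → ℝ) :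
    momentMatrix a x *ᵥ u = ∑ i, (a i * (x i ⬝ᵥ u)) • x i := by
  simp only [momentMatrix, Matrix.sum_mulVec, Matrix.smul_mulVec, Matrix.vecMulVec_mulVec,
    smul_smul, op_smul_eq_smul]

theorem dotProduct_momentMatrix_mulVec [Fintype α] [Fintype ι] (a : α → ℝ) (x : α → ι → ℝ) (u v : ι → ℝ) :
    u ⬝ᵥ (momentMatrix a x *ᵥ v) = ∑ i, a i * (x i ⬝ᵥ u) * (x i ⬝ᵥ v) := by
  rw [momentMatrix_mulVec, dotProduct_sum]
  refine Finset.sum_congr rfl fun i _ => ?_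
  rw [dotProduct_smul, smul_eq_mul, dotProduct_comm u]
  ring

theorem momentMatrix_isSymm [Fintype α] (a : α → ℝ) (x : α → ι → ℝ) : (momentMatrix a x).IsSymm := by
  ext k l
  simp [momentMatrix, Matrix.sum_apply, Matrix.vecMulVec_apply, mul_comm]

/-- Pairing with `u` gives ∑ a_i (x_i · u)² = 0, and the weights are positive. -/
theorem dotProduct_eq_zero_of_momentMatrix_mulVec [Fintype α] [Fintype ι] {a : α → ℝ}
    (ha : ∀ i, 0 < a i) {x : α → ι → ℝ} {u : ι → ℝ} (hu : momentMatrix a x *ᵥ u = 0) (i : α) :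
    x i ⬝ᵥ u = 0 := by
  have h1 : ∑ i, a i * (x i ⬝ᵥ u) * (x i ⬝ᵥ u) = 0 := by
    rw [← dotProduct_momentMatrix_mulVec, hu, dotProduct_zero]
  have h2 := (Finset.sum_eq_zero_iff_of_nonneg fun i _ => by
    rw [mul_assoc]; exact mul_nonneg (ha i).le (mul_self_nonneg _)).1 h1 i (Finset.mem_univ i)
  rw [mul_assoc] at h2
  exact mul_self_eq_zero.1 ((mul_eq_zero.1 h2).resolve_left (ha i).ne')

theorem isUnit_momentMatrix [Fintype α] [Fintype ι] [DecidableEq ι] {a : α → ℝ} (ha : ∀ i, 0 < a i) {x : α → ι → ℝ}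
    (hx : ∀ u, (∀ i, x i ⬝ᵥ u = 0) → u = 0) : IsUnit (momentMatrix a x) := by
  rw [← Matrix.mulVec_injective_iff_isUnit]
  exact (injective_iff_map_eq_zero (momentMatrix a x).mulVecLin).2 fun u hu =>
    hx u (dotProduct_eq_zero_of_momentMatrix_mulVec ha hu)

variable [Fintype ι]

/-- The stress on a complete bipartite graph attached to a matrix `N` and to two weighted
families of vectors. -/
def bipartiteStress (N : Matrix ι ι ℝ) (a : α → ℝ) (x : α → ι → ℝ) (b : β → ℝ)
    (y : β → ι → ℝ) : α ⊕ β → α ⊕ β → ℝ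
  | .inl i, .inr j => a i * b j * (x i ⬝ᵥ (N *ᵥ y j))
  | .inr j, .inl i => a i * b j * (x i ⬝ᵥ (N *ᵥ y j))
  | .inl _, .inl _ => 0
  | .inr _, .inr _ => 0

variable (N : Matrix ι ι ℝ) (a : α → ℝ) (x : α → ι → ℝ) (b : β → ℝ) (y : β → ι → ℝ)

theorem isStress_bipartiteStress :
    IsStress (completeBipartiteGraph α β) (bipartiteStress N a x b y) := by
  refine ⟨?_, ?_⟩
  · rintro (i | i) (j | j) <;> rfl
  · rintro (i | i) (j | j) h
    · rfl
    · simp [completeBipartiteGraph] at h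
    · simp [completeBipartiteGraph] at h
    · rfl

variable {N a x b y}

/-- The sum is a_i x_iᵗ N M u with M the moment matrix of `y`, which `N` cancels. Taking for `u` a
functional equal to 1 on every `y j` shows that the stresses at vertex i add up to a_i. -/
theorem sum_bipartiteStress_inl [Fintype β] [DecidableEq ι] (hN : momentMatrix b y * N = 1) (hNs : N.IsSymm)
    (i : α) (u : ι → ℝ) :
    ∑ j, bipartiteStress N a x b y (.inl i) (.inr j) * (y j ⬝ᵥ u) = a i * (x i ⬝ᵥ u) := by
  have h : ∀ j, bipartiteStress N a x b y (.inl i) (.inr j) * (y j ⬝ᵥ u) =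
      a i * (b j * (y j ⬝ᵥ (N *ᵥ x i)) * (y j ⬝ᵥ u)) := fun j => by
    have : x i ⬝ᵥ (N *ᵥ y j) = y j ⬝ᵥ (N *ᵥ x i) := by
      rw [Matrix.dotProduct_mulVec, ← Matrix.mulVec_transpose, hNs.eq, dotProduct_comm]
    simp only [bipartiteStress, this]
    ring
  rw [Finset.sum_congr rfl fun j _ => h j, ← Finset.mul_sum, ← dotProduct_momentMatrix_mulVec,
    Matrix.dotProduct_mulVec, ← Matrix.mulVec_transpose, (momentMatrix_isSymm b y).eq,
    Matrix.mulVec_mulVec, hN, Matrix.one_mulVec]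

theorem sum_bipartiteStress_inr [Fintype α] [DecidableEq ι] (hN : momentMatrix a x * N = 1) (j : β)
    (u : ι → ℝ) :
    ∑ i, bipartiteStress N a x b y (.inr j) (.inl i) * (x i ⬝ᵥ u) = b j * (y j ⬝ᵥ u) := by
  have h : ∀ i, bipartiteStress N a x b y (.inr j) (.inl i) * (x i ⬝ᵥ u) =
      b j * (a i * (x i ⬝ᵥ (N *ᵥ y j)) * (x i ⬝ᵥ u)) := fun i => by
    simp only [bipartiteStress]
    ring
  rw [Finset.sum_congr rfl fun i _ => h i, ← Finset.mul_sum, ← dotProduct_momentMatrix_mulVec,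
    Matrix.dotProduct_mulVec, ← Matrix.mulVec_transpose, (momentMatrix_isSymm a x).eq,
    Matrix.mulVec_mulVec, hN, Matrix.one_mulVec]

theorem IsStress.stressMatrix_mulVec {V : Type*} [Fintype V] [DecidableEq V] {G : SimpleGraph V}
    {ω : V → V → ℝ} (h : IsStress G ω) (z : V → ℝ) (v : V) :
    (stressMatrix ω *ᵥ z) v = ∑ w, ω v w * (z v - z w) := by
  have h0 : ω v v = 0 := h.2 v v (G.loopless.irrefl v)
  have h1 : ∀ w, stressMatrix ω v w * z w = (if v = w then (∑ k, ω v k) * z v else 0) -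
      ω v w * z w := fun w => by
    by_cases hvw : v = w
    · subst hvw
      simp [stressMatrix, h0]
    · simp [stressMatrix, hvw]
  simp only [Matrix.mulVec, dotProduct, h1, Finset.sum_sub_distrib, mul_sub, Finset.sum_mul]
  simp

section Fintype

variable [Fintype α] [Fintype β] [DecidableEq ι]

theorem stressMatrix_bipartiteStress_mulVec_inl [DecidableEq α] [DecidableEq β]
    (hN : momentMatrix b y * N = 1) (hNs : N.IsSymm)
    {e : ι → ℝ} (hxe : ∀ i, x i ⬝ᵥ e = 1) (hye : ∀ j, y j ⬝ᵥ e = 1) (z : α ⊕ β → ℝ) (i : α) :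
    (stressMatrix (bipartiteStress N a x b y) *ᵥ z) (.inl i) =
      a i * (z (.inl i) - x i ⬝ᵥ (N *ᵥ ∑ j, (b j * z (.inr j)) • y j)) := by
  have h := sum_bipartiteStress_inl (a := a) (x := x) hN hNs i e
  simp only [hxe, hye, mul_one] at h
  rw [(isStress_bipartiteStress N a x b y).stressMatrix_mulVec, Fintype.sum_sum_type]
  simp only [mul_sub, Finset.sum_sub_distrib, ← Finset.sum_mul, h]
  simp only [bipartiteStress, Matrix.mulVec_sum, dotProduct_sum, Matrix.mulVec_smul,
    dotProduct_smul, smul_eq_mul, Finset.mul_sum]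
  simp only [zero_mul, Finset.sum_const_zero, sub_zero, zero_add]
  exact congrArg _ (Finset.sum_congr rfl fun _ _ => by ring)

theorem stressMatrix_bipartiteStress_mulVec_inr [DecidableEq α] [DecidableEq β]
    (hN : momentMatrix a x * N = 1) (hNs : N.IsSymm)
    {e : ι → ℝ} (hxe : ∀ i, x i ⬝ᵥ e = 1) (hye : ∀ j, y j ⬝ᵥ e = 1) (z : α ⊕ β → ℝ) (j : β) :
    (stressMatrix (bipartiteStress N a x b y) *ᵥ z) (.inr j) =
      b j * (z (.inr j) - y j ⬝ᵥ (N *ᵥ ∑ i, (a i * z (.inl i)) • x i)) := by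
  have h := sum_bipartiteStress_inr (b := b) (y := y) hN j e
  simp only [hxe, hye, mul_one] at h
  have hs : ∀ i, x i ⬝ᵥ (N *ᵥ y j) = y j ⬝ᵥ (N *ᵥ x i) := fun i => by
    rw [Matrix.dotProduct_mulVec, ← Matrix.mulVec_transpose, hNs.eq, dotProduct_comm]
  rw [(isStress_bipartiteStress N a x b y).stressMatrix_mulVec, Fintype.sum_sum_type]
  simp only [mul_sub, Finset.sum_sub_distrib, ← Finset.sum_mul, h]
  simp only [bipartiteStress, Matrix.mulVec_sum, dotProduct_sum, Matrix.mulVec_smul,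
    dotProduct_smul, smul_eq_mul, Finset.mul_sum, hs]
  simp only [zero_mul, Finset.sum_const_zero, sub_zero, add_zero]
  exact congrArg _ (Finset.sum_congr rfl fun _ _ => by ring)

variable [DecidableEq α] [DecidableEq β]

theorem stressMatrix_bipartiteStress_mulVec_eq_zero (hNx : momentMatrix a x * N = 1)
    (hNy : momentMatrix b y * N = 1) (hNs : N.IsSymm) {e : ι → ℝ} (hxe : ∀ i, x i ⬝ᵥ e = 1)
    (hye : ∀ j, y j ⬝ᵥ e = 1) (u : ι → ℝ) :
    stressMatrix (bipartiteStress N a x b y) *ᵥ (fun v => Sum.elim x y v ⬝ᵥ u) = 0 := by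
  have hx : N *ᵥ ∑ i, (a i * (x i ⬝ᵥ u)) • x i = u := by
    rw [← momentMatrix_mulVec, Matrix.mulVec_mulVec, mul_eq_one_comm.1 hNx, Matrix.one_mulVec]
  have hy : N *ᵥ ∑ j, (b j * (y j ⬝ᵥ u)) • y j = u := by
    rw [← momentMatrix_mulVec, Matrix.mulVec_mulVec, mul_eq_one_comm.1 hNy, Matrix.one_mulVec]
  ext (i | j)
  · rw [stressMatrix_bipartiteStress_mulVec_inl hNy hNs hxe hye]
    simp [hy]
  · rw [stressMatrix_bipartiteStress_mulVec_inr hNx hNs hxe hye]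
    simp [hx]

/-- On a kernel vector, the equations at the first part say that its values there are x_i · u for
one vector `u`. Substituting this into the equations at the second part and cancelling `N` against
the moment matrix yields y_j · u with the same `u`. -/
theorem ker_stressMatrix_bipartiteStress (ha : ∀ i, 0 < a i) (hb : ∀ j, 0 < b j)
    (hNx : momentMatrix a x * N = 1) (hNy : momentMatrix b y * N = 1) (hNs : N.IsSymm)
    {e : ι → ℝ} (hxe : ∀ i, x i ⬝ᵥ e = 1) (hye : ∀ j, y j ⬝ᵥ e = 1) :
    LinearMap.ker (stressMatrix (bipartiteStress N a x b y)).mulVecLin =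
      LinearMap.range (Matrix.of (Sum.elim x y)).mulVecLin := by
  apply le_antisymm
  · intro z hz
    rw [LinearMap.mem_ker, Matrix.mulVecLin_apply] at hz
    have hzl : ∀ i, z (.inl i) = x i ⬝ᵥ (N *ᵥ ∑ j, (b j * z (.inr j)) • y j) := fun i => by
      have h := congrFun hz (.inl i)
      rw [stressMatrix_bipartiteStress_mulVec_inl hNy hNs hxe hye] at h
      exact sub_eq_zero.1 ((mul_eq_zero.1 h).resolve_left (ha i).ne')
    have hzr : ∀ j, z (.inr j) = y j ⬝ᵥ (N *ᵥ ∑ i, (a i * z (.inl i)) • x i) := fun j => by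
      have h := congrFun hz (.inr j)
      rw [stressMatrix_bipartiteStress_mulVec_inr hNx hNs hxe hye] at h
      exact sub_eq_zero.1 ((mul_eq_zero.1 h).resolve_left (hb j).ne')
    set u := N *ᵥ ∑ j, (b j * z (.inr j)) • y j with hu
    have hu' : N *ᵥ ∑ i, (a i * z (.inl i)) • x i = u := by
      simp only [hzl]
      rw [← momentMatrix_mulVec, Matrix.mulVec_mulVec, mul_eq_one_comm.1 hNx, Matrix.one_mulVec]
    refine ⟨u, ?_⟩
    ext (i | j)
    · exact (hzl i).symm
    · rw [hzr j, hu']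
      rfl
  · rintro _ ⟨u, rfl⟩
    exact stressMatrix_bipartiteStress_mulVec_eq_zero hNx hNy hNs hxe hye u

/-- By rank-nullity: non-degeneracy of `x` makes the parametrization of the kernel by `u` injective,
so the kernel has dimension `Fintype.card ι`. -/
theorem rank_stressMatrix_bipartiteStress (ha : ∀ i, 0 < a i) (hb : ∀ j, 0 < b j)
    (hNx : momentMatrix a x * N = 1) (hNy : momentMatrix b y * N = 1) (hNs : N.IsSymm)
    (hx : ∀ u, (∀ i, x i ⬝ᵥ u = 0) → u = 0)
    {e : ι → ℝ} (hxe : ∀ i, x i ⬝ᵥ e = 1) (hye : ∀ j, y j ⬝ᵥ e = 1) :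
    (stressMatrix (bipartiteStress N a x b y)).rank + Fintype.card ι = Fintype.card (α ⊕ β) := by
  have hinj : Function.Injective (Matrix.of (Sum.elim x y)).mulVecLin :=
    (injective_iff_map_eq_zero _).2 fun u hu => hx u fun i => congrFun hu (.inl i)
  have h := LinearMap.finrank_range_add_finrank_ker
    (stressMatrix (bipartiteStress N a x b y)).mulVecLin
  rwa [ker_stressMatrix_bipartiteStress ha hb hNx hNy hNs hxe hye,
    LinearMap.finrank_range_of_inj hinj, Module.finrank_fintype_fun_eq_card,
    Module.finrank_fintype_fun_eq_card] at h

theorem posSemidef_stressMatrix_bipartiteStress (ha : ∀ i, 0 < a i) (hb : ∀ j, 0 < b j)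
    (hM : momentMatrix a x = momentMatrix b y)
    (hNx : momentMatrix a x * N = 1) (hNs : N.IsSymm)
    {e : ι → ℝ} (hxe : ∀ i, x i ⬝ᵥ e = 1) (hye : ∀ j, y j ⬝ᵥ e = 1) :
    (stressMatrix (bipartiteStress N a x b y)).PosSemidef := by
  have hNy : momentMatrix b y * N = 1 := hM ▸ hNx
  have hω := isStress_bipartiteStress N a x b y
  refine .of_dotProduct_mulVec_nonneg ?_ fun z => ?_
  · ext v w
    by_cases hvw : v = w
    · subst hvw
      simp
    · simp [stressMatrix, hvw, Ne.symm hvw, hω.1 v w]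
  set α' := ∑ i, (a i * z (.inl i)) • x i with hα
  set β' := ∑ j, (b j * z (.inr j)) • y j with hβ
  set s := N *ᵥ α' with hs
  set t := N *ᵥ β' with ht
  have hMs : momentMatrix a x *ᵥ s = α' := by
    rw [hs, Matrix.mulVec_mulVec, hNx, Matrix.one_mulVec]
  have hMt : momentMatrix b y *ᵥ t = β' := by
    rw [ht, Matrix.mulVec_mulVec, hNy, Matrix.one_mulVec]
  have hαdot : ∀ u, ∑ i, a i * z (.inl i) * (x i ⬝ᵥ u) = ∑ i, a i * (x i ⬝ᵥ u) * (x i ⬝ᵥ s) := by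
    intro u
    rw [← dotProduct_momentMatrix_mulVec, hMs, hα, dotProduct_sum]
    exact Finset.sum_congr rfl fun i _ => by rw [dotProduct_smul, smul_eq_mul, dotProduct_comm]
  have hβdot : ∀ u, ∑ j, b j * z (.inr j) * (y j ⬝ᵥ u) = ∑ j, b j * (y j ⬝ᵥ u) * (y j ⬝ᵥ t) := by
    intro u
    rw [← dotProduct_momentMatrix_mulVec, hMt, hβ, dotProduct_sum]
    exact Finset.sum_congr rfl fun i _ => by rw [dotProduct_smul, smul_eq_mul, dotProduct_comm]
  have hab : ∀ u v, ∑ j, b j * (y j ⬝ᵥ u) * (y j ⬝ᵥ v) = ∑ i, a i * (x i ⬝ᵥ u) * (x i ⬝ᵥ v) := by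
    intro u v
    rw [← dotProduct_momentMatrix_mulVec, ← dotProduct_momentMatrix_mulVec, hM]
  -- The form equals ∑ a_i z_i² + ∑ b_j z_j² - 2 sᵗMt. Completing squares in both parts leaves (s -
  -- t)ᵗM(s - t), which is written as a sum over the first part.
  have key : star z ⬝ᵥ (stressMatrix (bipartiteStress N a x b y) *ᵥ z) =
      ∑ i, a i * ((z (.inl i) - x i ⬝ᵥ s) ^ 2 + (x i ⬝ᵥ s - x i ⬝ᵥ t) ^ 2) +
        ∑ j, b j * (z (.inr j) - y j ⬝ᵥ t) ^ 2 := by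
    have e1 : star z ⬝ᵥ (stressMatrix (bipartiteStress N a x b y) *ᵥ z) =
        (∑ i, a i * z (.inl i) * z (.inl i) - ∑ i, a i * z (.inl i) * (x i ⬝ᵥ t)) +
        (∑ j, b j * z (.inr j) * z (.inr j) - ∑ j, b j * z (.inr j) * (y j ⬝ᵥ s)) := by
      rw [dotProduct, Fintype.sum_sum_type]
      simp only [stressMatrix_bipartiteStress_mulVec_inl hNy hNs hxe hye,
        stressMatrix_bipartiteStress_mulVec_inr hNx hNs hxe hye, star_trivial,
        ← Finset.sum_sub_distrib]
      congr 1 <;> exact Finset.sum_congr rfl fun _ _ => by ring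
    have e2 : ∑ i, a i * ((z (.inl i) - x i ⬝ᵥ s) ^ 2 + (x i ⬝ᵥ s - x i ⬝ᵥ t) ^ 2) =
        ∑ i, a i * z (.inl i) * z (.inl i) - 2 * ∑ i, a i * z (.inl i) * (x i ⬝ᵥ s) +
        2 * ∑ i, a i * (x i ⬝ᵥ s) * (x i ⬝ᵥ s) - 2 * ∑ i, a i * (x i ⬝ᵥ t) * (x i ⬝ᵥ s) +
        ∑ i, a i * (x i ⬝ᵥ t) * (x i ⬝ᵥ t) := by
      simp only [Finset.mul_sum, ← Finset.sum_sub_distrib, ← Finset.sum_add_distrib]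
      exact Finset.sum_congr rfl fun _ _ => by ring
    have e3 : ∑ j, b j * (z (.inr j) - y j ⬝ᵥ t) ^ 2 =
        ∑ j, b j * z (.inr j) * z (.inr j) - 2 * ∑ j, b j * z (.inr j) * (y j ⬝ᵥ t) +
        ∑ j, b j * (y j ⬝ᵥ t) * (y j ⬝ᵥ t) := by
      simp only [Finset.mul_sum, ← Finset.sum_sub_distrib, ← Finset.sum_add_distrib]
      exact Finset.sum_congr rfl fun _ _ => by ring
    have e4 : ∑ i, a i * (x i ⬝ᵥ t) * (x i ⬝ᵥ s) = ∑ i, a i * (x i ⬝ᵥ s) * (x i ⬝ᵥ t) :=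
      Finset.sum_congr rfl fun _ _ => by ring
    rw [e1, e2, e3, hαdot, hαdot, hβdot, hβdot, hab, hab, e4]
    ring
  rw [key]
  exact add_nonneg
    (Finset.sum_nonneg fun i _ => mul_nonneg (ha i).le (add_nonneg (sq_nonneg _) (sq_nonneg _)))
    (Finset.sum_nonneg fun j _ => mul_nonneg (hb j).le (sq_nonneg _))

end Fintype

end BipartiteStress

/-- A complete bipartite framework is super stable if its two parts admit positive weights with
equal non-degenerate second moment matrices in homogeneous coordinates. -/
theorem spansAndSuperStable_of_momentMatrix_eq {α β : Type*} [Fintype α] [Fintype β]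
    [DecidableEq α] [DecidableEq β] {d : ℕ} (p : α → EuclideanSpace ℝ (Fin d))
    (q : β → EuclideanSpace ℝ (Fin d)) {a : α → ℝ} {b : β → ℝ} (ha : ∀ i, 0 < a i)
    (hb : ∀ j, 0 < b j)
    (hM : momentMatrix a (fun i => hat (p i)) = momentMatrix b (fun j => hat (q j)))
    (hp : ∀ u, (∀ i, hat (p i) ⬝ᵥ u = 0) → u = 0)
    (hq : ∀ u, (∀ j, hat (q j) ⬝ᵥ u = 0) → u = 0) :
    SpansAndSuperStable (completeBipartiteGraph α β) (Sum.elim p q) := by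
  set M := momentMatrix a (fun i => hat (p i)) with hMdef
  have hdet : IsUnit M.det := (Matrix.isUnit_iff_isUnit_det M).1 (isUnit_momentMatrix ha hp)
  have hNx : M * M⁻¹ = 1 := Matrix.mul_nonsing_inv M hdet
  have hNy : momentMatrix b (fun j => hat (q j)) * M⁻¹ = 1 := hM ▸ hNx
  have hNs : (M⁻¹).IsSymm := by
    rw [Matrix.IsSymm, Matrix.transpose_nonsing_inv, (momentMatrix_isSymm _ _).eq]
  have he : ∀ x : EuclideanSpace ℝ (Fin d), hat x ⬝ᵥ Pi.single (Fin.last d) 1 = 1 := fun x => by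
    simp [hat_last]
  refine ⟨affineSpan_eq_top_of_hat _ fun u hu => hp u fun i => hu (.inl i),
    ⟨bipartiteStress M⁻¹ a (fun i => hat (p i)) b fun j => hat (q j),
      ⟨isStress_bipartiteStress _ _ _ _ _, fun v => ?_⟩,
      posSemidef_stressMatrix_bipartiteStress ha hb hM hNx hNs (fun i => he _) fun j => he _, ?_⟩,
    not_onConicAtInfinity_of_hat p q hp hq _ fun i j => ⟨.inl i, .inr j, by simp, rfl⟩⟩
  -- Equilibrium in the k-th coordinate says that the vector of k-th coordinates lies in the kernel
  -- of the stress matrix.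
  · ext k
    have h := congrFun (stressMatrix_bipartiteStress_mulVec_eq_zero hNx hNy hNs (fun i => he (p i))
      (fun j => he (q j)) (Pi.single k.castSucc 1)) v
    rw [(isStress_bipartiteStress _ _ _ _ _).stressMatrix_mulVec] at h
    have hcoord : ∀ w, Sum.elim (fun i => hat (p i)) (fun j => hat (q j)) w ⬝ᵥ
        Pi.single k.castSucc 1 = (Sum.elim p q w) k := by
      rintro (i | j) <;> simp [hat]
    simp only [hcoord] at h
    simp only [WithLp.ofLp_sum, WithLp.ofLp_smul, WithLp.ofLp_sub, Finset.sum_apply,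
      Pi.smul_apply, Pi.sub_apply, smul_eq_mul]
    refine neg_eq_zero.1 (Eq.trans ?_ h)
    rw [← Finset.sum_neg_distrib]
    refine Finset.sum_congr rfl fun w _ => ?_
    rw [(isStress_bipartiteStress _ _ _ _ _).1 w v]
    ring
  · simpa using rank_stressMatrix_bipartiteStress ha hb hNx hNy hNs hp (fun i => he _)
      fun j => he _

/-! ### Positive linear dependencies -/

section Gordan

variable {E ι : Type*} [Fintype ι]

/-- Gordan's alternative: a finite family of vectors on which no linear functional is positive has
a non-trivial linear dependency with non-negative coefficients. -/
theorem exists_nonneg_dependency [AddCommGroup E] [Module ℝ E] [FiniteDimensional ℝ E]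
    (v : ι → E) (h : ∀ f : E →ₗ[ℝ] ℝ, ∃ i, f (v i) ≤ 0) :
    ∃ w : ι → ℝ, (∀ i, 0 ≤ w i) ∧ w ≠ 0 ∧ ∑ i, w i • v i = 0 := by
  -- `E` carries no topology, so the separation theorem is applied in coordinates.
  let φ := (Module.finBasis ℝ E).equivFun
  have h0 : (0 : Fin (Module.finrank ℝ E) → ℝ) ∈ convexHull ℝ (Set.range fun i => φ (v i)) := by
    by_contra hnot
    obtain ⟨f, u, hu, hf⟩ := geometric_hahn_banach_point_closed (convex_convexHull ℝ _)
      ((Set.finite_range _).isClosed_convexHull ℝ) hnot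
    obtain ⟨i, hi⟩ := h (f.toLinearMap ∘ₗ φ.toLinearMap)
    have h1 := hf (φ (v i)) (subset_convexHull ℝ _ (Set.mem_range_self i))
    rw [map_zero] at hu
    exact absurd (hu.trans h1) (not_lt.2 hi)
  rw [convexHull_range_eq_exists_affineCombination] at h0
  obtain ⟨s, w, hw0, hw1, hw⟩ := h0
  rw [s.affineCombination_eq_linear_combination _ _ hw1] at hw
  classical
  refine ⟨fun i => if i ∈ s then w i else 0, fun i => ?_, fun hzero => ?_, ?_⟩
  · dsimp only
    split_ifs with hi
    · exact hw0 i hi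
    · exact le_rfl
  · have : ∑ i ∈ s, w i = 0 := Finset.sum_eq_zero fun i hi => by
      simpa [hi] using congrFun hzero i
    exact one_ne_zero (hw1.symm.trans this)
  · apply φ.injective
    simpa [ite_smul, Finset.sum_ite_mem] using hw

/-- A non-negative dependency whose support spans the whole family can be made positive. -/
theorem exists_pos_dependency [AddCommGroup E] [Module ℝ E] (v : ι → E) (w : ι → ℝ)
    (hw0 : ∀ i, 0 ≤ w i) (hw : ∑ i, w i • v i = 0)
    (hspan : ∀ i, v i ∈ Submodule.span ℝ (v '' {i | w i ≠ 0})) :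
    ∃ w' : ι → ℝ, (∀ i, 0 < w' i) ∧ ∑ i, w' i • v i = 0 := by
  have hsum : ∑ i, v i ∈ Submodule.span ℝ (v '' {i | w i ≠ 0}) :=
    Submodule.sum_mem _ fun i _ => hspan i
  obtain ⟨c, hc, hcv⟩ := (Finsupp.mem_span_image_iff_linearCombination ℝ).1 hsum
  have hc0 : ∀ i, w i = 0 → c i = 0 := fun i hi => by
    by_contra hci
    exact (Finsupp.mem_supported ℝ c).1 hc (Finsupp.mem_support_iff.2 hci) hi
  rw [Finsupp.linearCombination_apply, Finsupp.sum_fintype _ _ (by simp)] at hcv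
  set t := ∑ i, |c i| / w i with ht
  -- Both `w` and `1 - c` are dependencies. Off the support of `w` the new weight is 1; on it, `t`
  -- is large enough that `t * w i ≥ |c i|`.
  refine ⟨fun i => t * w i + 1 - c i, fun i => ?_, ?_⟩
  · by_cases hi : w i = 0
    · simp [hi, hc0 i hi]
    · have h1 : |c i| / w i ≤ t := Finset.single_le_sum (f := fun i => |c i| / w i)
        (fun j _ => div_nonneg (abs_nonneg _) (hw0 j)) (Finset.mem_univ i)
      have h2 := (div_le_iff₀ (lt_of_le_of_ne (hw0 i) (Ne.symm hi))).1 h1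
      linarith [le_abs_self (c i)]
  · simp only [sub_smul, add_smul, one_smul, mul_smul, Finset.sum_sub_distrib,
      Finset.sum_add_distrib, ← Finset.smul_sum, hw, hcv]
    simp

end Gordan

/-! ### Symmetric matrices and the Veronese map -/

/-- Linearly independent symmetric matrices, as many as the dimension of the space of symmetric
matrices, span it. -/
theorem mem_span_of_isSymm {m : ℕ} {κ : Type*} [Fintype κ] (u : κ → Matrix (Fin m) (Fin m) ℝ)
    (hu : LinearIndependent ℝ u) (hsymm : ∀ k, (u k).IsSymm)
    (hcard : (m + 1).choose 2 ≤ Fintype.card κ) (A : Matrix (Fin m) (Fin m) ℝ) (hA : A.IsSymm) :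
    A ∈ Submodule.span ℝ (Set.range u) := by
  let L : (Sym2 (Fin m) → ℝ) →ₗ[ℝ] Matrix (Fin m) (Fin m) ℝ :=
    { toFun := fun f => Matrix.of fun i j => f s(i, j)
      map_add' := fun _ _ => rfl
      map_smul' := fun _ _ => rfl }
  have hL : ∀ B : Matrix (Fin m) (Fin m) ℝ, B.IsSymm → B ∈ LinearMap.range L := fun B hB =>
    ⟨Sym2.lift ⟨fun i j => B i j, fun i j => hB.apply j i⟩, rfl⟩
  have hle : Submodule.span ℝ (Set.range u) ≤ LinearMap.range L :=
    Submodule.span_le.2 (Set.range_subset_iff.2 fun k => hL _ (hsymm k))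
  have hfin : Module.finrank ℝ (LinearMap.range L) ≤
      Module.finrank ℝ (Submodule.span ℝ (Set.range u)) := by
    rw [finrank_span_eq_card hu]
    refine (LinearMap.finrank_range_le L).trans ?_
    rwa [Module.finrank_fintype_fun_eq_card, Sym2.card, Fintype.card_fin]
  rw [Submodule.eq_of_le_of_finrank_le hle hfin]
  exact hL A hA

section Veronese

variable {d : ℕ}

theorem veronese_isSymm (x : EuclideanSpace ℝ (Fin d)) : (veronese x).IsSymm := by
  ext i j
  simp [veronese, Matrix.vecMulVec_apply, mul_comm]

theorem veronese_last_last (x : EuclideanSpace ℝ (Fin d)) :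
    veronese x (Fin.last d) (Fin.last d) = 1 := by
  simp [veronese, Matrix.vecMulVec_apply, hat_last]

/-- In a configuration in quadric general position, the Veronese images of as many points as the
dimension of the space of symmetric matrices are linearly independent. -/
theorem QuadricGeneralPosition.linearIndependent {ι : Type*}
    {p : ι → EuclideanSpace ℝ (Fin d)} (h : QuadricGeneralPosition p) (s : Finset ι)
    (hs : s.card ≤ (d + 1) * (d + 2) / 2) :
    LinearIndependent ℝ fun i : s => veronese (p i) := by
  have haff : AffineIndependent ℝ fun i : s => veronese (p i) := by
    rcases Nat.lt_or_ge s.card 2 with hlt | hge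
    · have : Subsingleton s := by
        rw [← Fintype.card_le_one_iff_subsingleton, Fintype.card_coe]
        omega
      exact affineIndependent_of_subsingleton ℝ _
    · obtain ⟨k, hk⟩ : ∃ k, s.card = k + 1 := ⟨s.card - 1, by omega⟩
      have hspan := h k (by omega) (by omega) s hk
      rw [direction_affineSpan] at hspan
      rw [affineIndependent_iff_finrank_vectorSpan_eq ℝ _ (n := k) (by simpa using hk)]
      rwa [Set.image_eq_range] at hspan
  rw [Fintype.linearIndependent_iff]
  intro g hg i
  -- The last diagonal entry of every Veronese image is 1, so a linear dependency among them is
  -- automatically an affine one.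
  have hsum : ∑ i, g i = 0 := by
    have := congrFun (congrFun hg (Fin.last d)) (Fin.last d)
    simpa [Matrix.sum_apply, veronese_last_last] using this
  exact affineIndependent_iff.1 haff Finset.univ g hsum hg i (Finset.mem_univ i)

/-- A linear functional evaluates on Veronese images as a quadric. -/
theorem exists_isSymm_quadric (f : Matrix (Fin (d + 1)) (Fin (d + 1)) ℝ →ₗ[ℝ] ℝ) :
    ∃ A : Matrix (Fin (d + 1)) (Fin (d + 1)) ℝ, A.IsSymm ∧
      ∀ x : EuclideanSpace ℝ (Fin d), hat x ⬝ᵥ (A *ᵥ hat x) = 2 * f (veronese x) := by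
  set B : Matrix (Fin (d + 1)) (Fin (d + 1)) ℝ :=
    Matrix.of fun i j => f (Matrix.single i j 1) with hB
  have hf : ∀ x : EuclideanSpace ℝ (Fin d), hat x ⬝ᵥ (B *ᵥ hat x) = f (veronese x) := by
    intro x
    conv_rhs => rw [Matrix.matrix_eq_sum_single (veronese x)]
    simp only [map_sum, dotProduct, Matrix.mulVec, Finset.mul_sum]
    refine Finset.sum_congr rfl fun i _ => Finset.sum_congr rfl fun j _ => ?_
    have : Matrix.single i j (veronese x i j) = veronese x i j • Matrix.single i j (1 : ℝ) := by
      rw [Matrix.smul_single, smul_eq_mul, mul_one]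
    rw [this, map_smul, hB, Matrix.of_apply, smul_eq_mul, veronese, Matrix.vecMulVec_apply]
    ring
  -- Symmetrizing without halving accounts for the factor 2.
  refine ⟨B + Bᵀ, Matrix.isSymm_add_transpose_self B, fun x => ?_⟩
  rw [Matrix.add_mulVec, dotProduct_add, Matrix.mulVec_transpose, dotProduct_comm _ (hat x ᵥ* B),
    ← Matrix.dotProduct_mulVec, hf]
  ring

/-- If the Veronese images of a family span the symmetric matrices, then its homogeneous
coordinate vectors are non-degenerate. -/
theorem eq_zero_of_forall_hat_dotProduct_eq_zero {ι : Type*} {r : ι → EuclideanSpace ℝ (Fin d)}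
    (hspan : ∀ A : Matrix (Fin (d + 1)) (Fin (d + 1)) ℝ, A.IsSymm →
      A ∈ Submodule.span ℝ (Set.range fun i => veronese (r i)))
    {u : Fin (d + 1) → ℝ} (hu : ∀ i, hat (r i) ⬝ᵥ u = 0) : u = 0 := by
  have hker : ∀ A ∈ Submodule.span ℝ (Set.range fun i => veronese (r i)), A *ᵥ u = 0 := by
    intro A hA
    induction hA using Submodule.span_induction with
    | mem A hA =>
      obtain ⟨i, rfl⟩ := hA
      simp [veronese, Matrix.vecMulVec_mulVec, hu i]
    | zero => exact Matrix.zero_mulVec u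
    | add A B _ _ hA hB => rw [Matrix.add_mulVec, hA, hB, add_zero]
    | smul c A _ hA => rw [Matrix.smul_mulVec, hA, smul_zero]
  -- Every matrix in the span annihilates `u`, and the identity is one of them.
  simpa using hker 1 (hspan 1 Matrix.isSymm_one)

end Veronese

/-! ### Weights on configurations that no quadric separates -/

section Weights

variable {α β : Type*} {d : ℕ}

/-- The Veronese images of the first configuration together with the negated Veronese images of
the second one. -/
def signedVeronese (p : α → EuclideanSpace ℝ (Fin d)) (q : β → EuclideanSpace ℝ (Fin d)) :
    α ⊕ β → Matrix (Fin (d + 1)) (Fin (d + 1)) ℝ :=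
  Sum.elim (fun i => veronese (p i)) fun j => -veronese (q j)

theorem mem_span_signedVeronese_iff (p : α → EuclideanSpace ℝ (Fin d))
    (q : β → EuclideanSpace ℝ (Fin d)) (S : Submodule ℝ (Matrix (Fin (d + 1)) (Fin (d + 1)) ℝ))
    (k : α ⊕ β) : signedVeronese p q k ∈ S ↔ veronese (Sum.elim p q k) ∈ S := by
  rcases k with i | j
  · rfl
  · exact S.neg_mem_iff

theorem exists_nonneg_dependency_of_not_separated [Fintype α] [Fintype β]
    (p : α → EuclideanSpace ℝ (Fin d)) (q : β → EuclideanSpace ℝ (Fin d))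
    (hsep : ¬ StrictlySeparatedByQuadric p q) :
    ∃ w : α ⊕ β → ℝ, (∀ k, 0 ≤ w k) ∧ w ≠ 0 ∧ ∑ k, w k • signedVeronese p q k = 0 := by
  refine exists_nonneg_dependency _ fun f => ?_
  by_contra! hf
  apply hsep
  obtain ⟨A, hA, hAf⟩ := exists_isSymm_quadric f
  -- If `A = 0`, then `f` vanishes on all Veronese images, so both families are empty and any
  -- non-zero symmetric matrix separates them vacuously.
  by_cases hA0 : A = 0
  · have hp : ∀ i : α, False := fun i => by
      have h1 := hAf (p i)
      have h2 := hf (.inl i)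
      simp only [hA0, Matrix.zero_mulVec, dotProduct_zero] at h1
      simp only [signedVeronese, Sum.elim_inl] at h2
      linarith
    have hq : ∀ j : β, False := fun j => by
      have h1 := hAf (q j)
      have h2 := hf (.inr j)
      simp only [hA0, Matrix.zero_mulVec, dotProduct_zero] at h1
      simp only [signedVeronese, Sum.elim_inr, map_neg] at h2
      linarith
    exact ⟨1, Matrix.isSymm_one, one_ne_zero, fun i => (hp i).elim, fun j => (hq j).elim⟩
  · refine ⟨A, hA, hA0, fun i => ?_, fun j => ?_⟩
    · have h2 := hf (.inl i)
      simp only [signedVeronese, Sum.elim_inl] at h2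
      rw [hAf]
      linarith
    · have h2 := hf (.inr j)
      simp only [signedVeronese, Sum.elim_inr, map_neg] at h2
      rw [hAf]
      linarith

/-- In quadric general position, a non-trivial dependency of signed Veronese images involves more
points than the dimension of the space of symmetric matrices. -/
theorem QuadricGeneralPosition.lt_card_support [Fintype α] [Fintype β] [DecidableEq α]
    [DecidableEq β] {p : α → EuclideanSpace ℝ (Fin d)} {q : β → EuclideanSpace ℝ (Fin d)}
    (hgen : QuadricGeneralPosition (Sum.elim p q)) {w : α ⊕ β → ℝ} (hw0 : w ≠ 0)
    (hw : ∑ k, w k • signedVeronese p q k = 0) :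
    (d + 1) * (d + 2) / 2 < (Finset.univ.filter fun k => w k ≠ 0).card := by
  by_contra! hle
  set T := Finset.univ.filter fun k => w k ≠ 0 with hT
  have hli := Fintype.linearIndependent_iff.1 (hgen.linearIndependent T hle)
    -- The sign of the second part moves from the vectors into the coefficients.
    (fun k => Sum.elim (fun _ => w k) (fun _ => -w k) k.1) (by
      rw [← hw, ← Finset.sum_subset (Finset.subset_univ T), ← Finset.sum_coe_sort T]
      · refine Finset.sum_congr rfl fun k _ => ?_
        obtain ⟨i | j, hk⟩ := k <;> simp [signedVeronese]
      · intro k _ hk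
        have : w k = 0 := by simpa [hT] using hk
        rw [this, zero_smul])
  apply hw0
  ext k
  by_contra hk
  have := hli ⟨k, by simpa [hT] using hk⟩
  rcases k with i | j <;> simp at this hk <;> exact hk this

/-- Suppose that two configurations contain subconfigurations which are jointly in quadric general
position and not strictly separated by a quadric. Then there are positive weights on them with
equal second moment matrices, the Veronese images of the points span the symmetric matrices, and
there are more points than the dimension of the space of symmetric matrices. -/
theorem exists_pos_weights_of_not_separated [Fintype α] [Fintype β] [DecidableEq α]
    [DecidableEq β] (p : α → EuclideanSpace ℝ (Fin d)) (q : β → EuclideanSpace ℝ (Fin d))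
    (I : Finset α) (J : Finset β)
    (hgen : QuadricGeneralPosition (Sum.elim (fun i : I => p i) (fun j : J => q j)))
    (hsep : ¬ StrictlySeparatedByQuadric (fun i : I => p i) (fun j : J => q j)) :
    (d + 1) * (d + 2) / 2 + 1 ≤ Fintype.card α + Fintype.card β ∧
    (∀ u, (∀ k, hat (Sum.elim p q k) ⬝ᵥ u = 0) → u = 0) ∧
    ∃ (a : α → ℝ) (b : β → ℝ), (∀ i, 0 < a i) ∧ (∀ j, 0 < b j) ∧
      momentMatrix a (fun i => hat (p i)) = momentMatrix b (fun j => hat (q j)) := by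
  obtain ⟨w, hw, hw0, hsum⟩ := exists_nonneg_dependency_of_not_separated _ _ hsep
  have hcard := hgen.lt_card_support hw0 hsum
  obtain ⟨T, hTsub, hTcard⟩ := Finset.exists_subset_card_eq hcard.le
  set g : I ⊕ J → α ⊕ β := Sum.map Subtype.val Subtype.val with hg
  have hgr : ∀ k, Sum.elim (fun i : I => p i) (fun j : J => q j) k = Sum.elim p q (g k) := by
    rintro (i | j) <;> rfl
  have hgv : ∀ k, signedVeronese (fun i : I => p i) (fun j : J => q j) k =
      signedVeronese p q (g k) := by
    rintro (i | j) <;> rfl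
  have hspan : ∀ A : Matrix (Fin (d + 1)) (Fin (d + 1)) ℝ, A.IsSymm →
      A ∈ Submodule.span ℝ (Set.range fun k : T => veronese (Sum.elim p q (g k))) := by
    have hli := hgen.linearIndependent T hTcard.le
    simp only [hgr] at hli
    refine mem_span_of_isSymm _ hli (fun k => veronese_isSymm _) ?_
    rw [Fintype.card_coe, hTcard, Nat.choose_two_right, Nat.add_sub_cancel, mul_comm]
  refine ⟨?_, fun u hu => eq_zero_of_forall_hat_dotProduct_eq_zero hspan fun k => hu _, ?_⟩
  · calc (d + 1) * (d + 2) / 2 + 1 ≤ (Finset.univ.filter fun k => w k ≠ 0).card := hcard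
      _ ≤ Fintype.card (I ⊕ J) := Finset.card_le_univ _
      _ ≤ Fintype.card α + Fintype.card β := by
        rw [Fintype.card_sum, Fintype.card_coe, Fintype.card_coe]
        exact add_le_add (Finset.card_le_univ _) (Finset.card_le_univ _)
  -- `w₁` extends `w` by zero from the subconfigurations to all points.
  · set w₁ : α ⊕ β → ℝ := fun l => ∑ k, if g k = l then w k else 0 with hw₁
    have hnn : ∀ l k, 0 ≤ if g k = l then w k else 0 := fun l k => by
      split_ifs
      · exact hw k
      · exact le_rfl
    obtain ⟨w', hpos, hw'⟩ := exists_pos_dependency (signedVeronese p q) w₁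
      (fun l => Finset.sum_nonneg fun k _ => hnn l k)
      (by
        rw [← hsum]
        simp only [hw₁, Finset.sum_smul, ite_smul, zero_smul, hgv]
        rw [Finset.sum_comm]
        simp)
      (fun l => by
        have hle : Submodule.span ℝ (Set.range fun k : T => veronese (Sum.elim p q (g k))) ≤
            Submodule.span ℝ (signedVeronese p q '' {l | w₁ l ≠ 0}) := by
          refine Submodule.span_le.2 (Set.range_subset_iff.2 fun k => ?_)
          refine (mem_span_signedVeronese_iff p q _ _).1 (Submodule.subset_span ⟨g k, ?_, rfl⟩)
          have hk : w k ≠ 0 := by simpa using hTsub k.2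
          have h1 := Finset.single_le_sum (f := fun i => if g i = g k then w i else 0)
            (fun i _ => hnn (g k) i) (Finset.mem_univ k.1)
          simp only [if_true] at h1
          exact (lt_of_lt_of_le (lt_of_le_of_ne (hw k) (Ne.symm hk)) h1).ne'
        exact hle ((mem_span_signedVeronese_iff p q _ _).2 (hspan _ (veronese_isSymm _))))
    refine ⟨fun i => w' (.inl i), fun j => w' (.inr j), fun i => hpos _, fun j => hpos _, ?_⟩
    rw [Fintype.sum_sum_type] at hw'
    simp only [signedVeronese, Sum.elim_inl, Sum.elim_inr, smul_neg, Finset.sum_neg_distrib,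
      ← sub_eq_add_neg] at hw'
    exact sub_eq_zero.1 hw'

end Weights

theorem mainTheorem4 (d n m : ℕ) (p : Fin n → EuclideanSpace ℝ (Fin d))
    (q : Fin m → EuclideanSpace ℝ (Fin d)) (I : Finset (Fin n)) (J : Finset (Fin m))
    (hgen : QuadricGeneralPosition (Sum.elim (fun i : I => p i) (fun j : J => q j)))
    (hsep : ¬ StrictlySeparatedByQuadric (fun i : I => p i) (fun j : J => q j)) :
    IsSuperStable (completeBipartiteGraph (Fin n) (Fin m)) (Sum.elim p q) ∧
    (d + 1) * (d + 2) / 2 + 1 ≤ n + m ∧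
    affineSpan ℝ (Set.range p) = affineSpan ℝ (Set.range q) ∧
    affineSpan ℝ (Set.range p) = ⊤ := by
  obtain ⟨hcard, hnd, a, b, ha, hb, hM⟩ := exists_pos_weights_of_not_separated p q I J hgen hsep
  -- A vector orthogonal to one part is annihilated by the common moment matrix, hence is orthogonal
  -- to the other part as well.
  have hp : ∀ u, (∀ i, hat (p i) ⬝ᵥ u = 0) → u = 0 := fun u hu => hnd u fun k => by
    have h0 : momentMatrix b (fun j => hat (q j)) *ᵥ u = 0 := by
      simp [← hM, momentMatrix_mulVec, hu]
    rcases k with i | j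
    · exact hu i
    · exact dotProduct_eq_zero_of_momentMatrix_mulVec hb h0 j
  have hq : ∀ u, (∀ j, hat (q j) ⬝ᵥ u = 0) → u = 0 := fun u hu => hnd u fun k => by
    have h0 : momentMatrix a (fun i => hat (p i)) *ᵥ u = 0 := by
      simp [hM, momentMatrix_mulVec, hu]
    rcases k with i | j
    · exact dotProduct_eq_zero_of_momentMatrix_mulVec ha h0 i
    · exact hu j
  have hptop := affineSpan_eq_top_of_hat p hp
  exact ⟨⟨d, AffineIsometry.id, Sum.elim p q, fun _ => rfl,
    spansAndSuperStable_of_momentMatrix_eq p q ha hb hM hp hq⟩, by simpa using hcard,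
    hptop.trans (affineSpan_eq_top_of_hat q hq).symm, hptop⟩
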